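/- Let $\mathbb K$ be a field and let $\mathcal S$ be a numerical semigroup (a submonoid of $\mathbb N$ generated by a finite set of relatively prime positive integers) minimally generated by the set $A=\{a_1,\dots,a_n\}$ of $n$ distinct positive integers, that is, $A$ generates $\mathcal S$ and no proper subset of $A$ does. For $\mathbf u\in\mathbb N^n$ let $\deg_A(\mathbf x^{\mathbf u})=\sum_i u_ia_i$, and let $$I_A=\langle \mathbf x^{\mathbf u}-\mathbf x^{\mathbf v}\mid \deg_A(\mathbf x^{\mathbf u})=\deg_A(\mathbf x^{\mathbf v})\rangle\subseteq\mathbb K[x_1,\dots,x_n]$$ be the toric ideal of $A$. A *binomial* is a nonzero polynomial of the form $\mathbf x^{\mathbf u}-\mathbf x^{\mathbf v}$. A *Markov basis* of $I_A$ is a set of binomials that generates $I_A$ and is minimal for inclusion with this property. The *Betti degrees* of $I_A$ are the $A$-degrees of the elements of Markov bases, and $\mathcal S$ is *Betti divisible* if its Betti degrees are totally ordered by divisibility. Consider the following sets. - $\mathcal C_A$, the set of circuits: binomials $\mathbf x^{\mathbf u}-\mathbf x^{\mathbf v}\in I_A$ such that $\operatorname{supp}(\mathbf u)\cap\operatorname{supp}(\mathbf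 v)=\emptyset$, the nonzero entries of $\mathbf u+\mathbf v$ have greatest common divisor $1$, and no binomial $\mathbf x^{\mathbf u'}-\mathbf x^{\mathbf v'}\in I_A$ satisfies $\operatorname{supp}(\mathbf u')\cup\operatorname{supp}(\mathbf v')\subsetneq\operatorname{supp}(\mathbf u)\cup\operatorname{supp}(\mathbf v)$. - $\mathcal U_A$, the universal Gröbner basis: the union, over all monomial orders, of the reduced Gröbner bases of $I_A$. - $\operatorname{Cr}_A$, the set of critical binomials: all $\pm\bigl(x_i^{c_i}-\prod_{j\ne i}x_j^{r_j}\bigr)$ with $1\le i\le n$, where $c_i$ is the least positive integer with $c_ia_i\in\langle a_j\mid j\ne i\rangle$, $r_j\in\mathbb N$, and $c_ia_i=\sum_{j\neq i}r_ja_j$ (there are none if $n=1$). - $\mathcal M_A$, the universal Markov basis: the union of all Markov bases of $I_A$. - $\operatorname{Gr}_A$, the Graver basis: binomials $\mathbf x^{\mathbf u}-\mathbf x^{\mathbf v}\in I_A$ such that no binomial $\mathbf x^{\mathbf w}-\mathbf x^{\mathbf z}\in I_A$ with $(\mathbf w,\mathbf z)\ne(\mathbf u,\mathbf v)$ satisfies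 $\mathbf x^{\mathbf w}\mid\mathbf x^{\mathbf u}$ and $\mathbf x^{\mathbf z}\mid\mathbf x^{\mathbf v}$. If $\mathcal S$ is Betti divisible, then $$\mathcal C_A=\mathcal U_A\subseteq\operatorname{Cr}_A=\mathcal M_A=\operatorname{Gr}_A .$$ -/

import Mathlib

noncomputable section

namespace ToricBases

open MvPolynomial

/-- A numerical semigroup: a submonoid of `ℕ` generated by a finite set of relatively prime
positive integers. -/
def IsNumericalSemigroup (S : AddSubmonoid ℕ) : Prop :=
  ∃ A : Finset ℕ, (∀ x ∈ A, 0 < x) ∧ A.gcd id = 1 ∧ S = AddSubmonoid.closure (A : Set ℕ)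

/-- `S` is minimally generated by the set `{a 0, …, a (n - 1)}` of `n` positive integers:
this set generates `S`, and no proper subset of it does. -/
structure IsMinimallyGeneratedBy (S : AddSubmonoid ℕ) {n : ℕ} (a : Fin n → ℕ) : Prop where
  injective : Function.Injective a
  pos : ∀ i, 0 < a i
  closure_eq : AddSubmonoid.closure (Set.range a) = S
  minimal : ∀ T : Set ℕ, T ⊂ Set.range a → AddSubmonoid.closure T ≠ S

variable {n : ℕ}

/-- The `A`-degree `u₁ a₁ + ⋯ + uₙ aₙ` of the monomial `x^u`. -/
def aDegree (a : Fin n → ℕ) (u : Fin n →₀ ℕ) : ℕ := ∑ i, u i * a i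

variable (K : Type*) [Field K]

/-- The pure difference binomial `x^u - x^v`. -/
def binom (u v : Fin n →₀ ℕ) : MvPolynomial (Fin n) K :=
  monomial u (1 : K) - monomial v (1 : K)

/-- The toric ideal `I_A`. -/
def toricIdeal (a : Fin n → ℕ) : Ideal (MvPolynomial (Fin n) K) :=
  Ideal.span {f | ∃ u v : Fin n →₀ ℕ, aDegree a u = aDegree a v ∧ f = binom K u v}

/-- A Markov basis of `I_A`: a generating set consisting of binomials which is minimal for
inclusion. -/
def IsMarkovBasis (a : Fin n → ℕ) (B : Set (MvPolynomial (Fin n) K)) : Prop :=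
  (∀ f ∈ B, ∃ u v : Fin n →₀ ℕ, f = binom K u v) ∧
  Ideal.span B = toricIdeal K a ∧
  ∀ B' : Set (MvPolynomial (Fin n) K), B' ⊂ B → Ideal.span B' ≠ toricIdeal K a

/-- The universal Markov basis: the union of all Markov bases. It contains, with each binomial,
its opposite. -/
def universalMarkovBasis (a : Fin n → ℕ) : Set (MvPolynomial (Fin n) K) :=
  {f | ∃ B, IsMarkovBasis K a B ∧ f ∈ B}

/-- The Betti degrees: the `A`-degrees of the elements of Markov bases. -/
def bettiDegrees (a : Fin n → ℕ) : Set ℕ :=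
  {b | ∃ B, IsMarkovBasis K a B ∧ ∃ u v : Fin n →₀ ℕ, binom K u v ∈ B ∧ aDegree a u = b}

/-- Betti divisibility: the Betti degrees are (totally) ordered by divisibility. -/
def IsBettiDivisible (a : Fin n → ℕ) : Prop :=
  ∀ b ∈ bettiDegrees K a, ∀ b' ∈ bettiDegrees K a, b ∣ b' ∨ b' ∣ b

/-- The Graver basis: the set of primitive binomials of `I_A`. "Binomial" means a nonzero one. -/
def graverBasis (a : Fin n → ℕ) : Set (MvPolynomial (Fin n) K) :=
  {f | ∃ u v : Fin n →₀ ℕ, f = binom K u v ∧ u ≠ v ∧ binom K u v ∈ toricIdeal K a ∧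
    ∀ w z : Fin n →₀ ℕ, w ≠ z → binom K w z ∈ toricIdeal K a → w ≤ u → z ≤ v → w = u ∧ z = v}

/-- The set of circuits: the irreducible binomials of `I_A` (disjoint supports, relatively prime
nonzero exponents) whose support is minimal among those of the nonzero binomials of `I_A`. -/
def circuits (a : Fin n → ℕ) : Set (MvPolynomial (Fin n) K) :=
  {f | ∃ u v : Fin n →₀ ℕ, f = binom K u v ∧ u ≠ v ∧ binom K u v ∈ toricIdeal K a ∧
    Disjoint u.support v.support ∧ (u + v).support.gcd (u + v) = 1 ∧
    ∀ u' v' : Fin n →₀ ℕ, u' ≠ v' → binom K u' v' ∈ toricIdeal K a →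
      ¬ (u'.support ∪ v'.support ⊂ u.support ∪ v.support)}

/-- `f = x_i ^ c - ∏_{j ≠ i} x_j ^ (r j)` is a critical binomial with respect to `x_i`, where
`c` is the least positive integer such that `c * a i` lies in the monoid generated by the
`a j`, `j ≠ i`. -/
def IsCriticalBinomial (a : Fin n → ℕ) (i : Fin n) (f : MvPolynomial (Fin n) K) : Prop :=
  ∃ (c : ℕ) (r : Fin n →₀ ℕ),
    IsLeast {c : ℕ | 0 < c ∧ c * a i ∈ AddSubmonoid.closure (a '' {j | j ≠ i})} c ∧
    r i = 0 ∧ c * a i = aDegree a r ∧ f = binom K (Finsupp.single i c) r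

/-- The set of critical binomials. Binomials with opposite signs are identified, i.e. the set
contains with each binomial also its opposite. -/
def criticalBinomials (a : Fin n → ℕ) : Set (MvPolynomial (Fin n) K) :=
  {f | ∃ i, IsCriticalBinomial K a i f ∨ IsCriticalBinomial K a i (-f)}

variable {K}

/-- `G` is a Gröbner basis of the ideal `I` with respect to the monomial order `m`. -/
def IsGroebnerBasis (m : MonomialOrder (Fin n)) (I : Ideal (MvPolynomial (Fin n) K))
    (G : Set (MvPolynomial (Fin n) K)) : Prop :=
  G.Finite ∧ G ⊆ I ∧
  Ideal.span (m.leadingTerm '' G) =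
    Ideal.span (m.leadingTerm '' (I : Set (MvPolynomial (Fin n) K)))

/-- `G` is the reduced Gröbner basis of `I` with respect to `m`: its elements are monic, and no
monomial of an element of `G` is divisible by the leading monomial of another one. -/
def IsReducedGroebnerBasis (m : MonomialOrder (Fin n)) (I : Ideal (MvPolynomial (Fin n) K))
    (G : Set (MvPolynomial (Fin n) K)) : Prop :=
  IsGroebnerBasis m I G ∧ (∀ g ∈ G, m.Monic g) ∧
  ∀ g ∈ G, ∀ h ∈ G, h ≠ g → ∀ u ∈ g.support, ¬ m.degree h ≤ u

variable (K)

/-- The universal Gröbner basis: the union of all reduced Gröbner bases, over all monomial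
orders. Every monomial order can be realised with a synonym type in `Type`. -/
def universalGroebnerBasis (a : Fin n → ℕ) : Set (MvPolynomial (Fin n) K) :=
  {f | ∃ (m : MonomialOrder.{0, 0} (Fin n)) (G : Set (MvPolynomial (Fin n) K)),
    IsReducedGroebnerBasis m (toricIdeal K a) G ∧ f ∈ G}

end ToricBases

end

namespace ToricBases

/-! ### Degrees, isolated monomials, critical exponents and primitive pairs. -/

section Combinatorics

variable {n : ℕ} {a : Fin n → ℕ}

/-! Call a monomial isolated if it shares no variable with any other monomial of its degree. An
isolated monomial with a companion in its degree lies in an element of some Markov basis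
(`exists_isMarkovBasis`), so its degree is a Betti degree. This is the only way Betti divisibility
enters. Since the critical powers `x_i ^ c_i` are isolated, the numbers `c_i a_i` form a chain under
divisibility.

A monomial with all exponents below the critical ones is alone in its degree
(`eq_of_lt_criticalExponent`). Reducing exponents modulo the `c_i` then shows that in a primitive
binomial every exponent is a multiple of the critical one (`IsPrimitivePair.dvd_left`). Such a
binomial is a coin problem whose coins `c_i a_i` form a divisibility chain: the side containing the
largest coin `c_j a_j` must be that single coin, since the other side can pay it exactly. Hence Gr ⊆
Cr. The inclusions Cr ⊆ M (isolation) and M ⊆ Gr (graded minimality) need no divisibility and close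
the cycle.

For U = C, a reduced Gröbner binomial is primitive, so one side is a critical power. If the other
side had two variables, its two smallest coins would give distinct proper divisors of equal degree,
both standard, although a degree has only one standard monomial. So both sides are pure powers and
the binomial is a circuit. Conversely, circuits are reduced for a suitable lexicographic order. -/

theorem aDegree_eq_weight (a : Fin n → ℕ) (u : Fin n →₀ ℕ) :
    aDegree a u = Finsupp.weight a u := by
  simp [aDegree, Finsupp.weight_eq_sum]

@[simp] theorem aDegree_zero (a : Fin n → ℕ) : aDegree a 0 = 0 := by simp [aDegree]

theorem aDegree_add (a : Fin n → ℕ) (u v : Fin n →₀ ℕ) :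
    aDegree a (u + v) = aDegree a u + aDegree a v := by
  simp [aDegree_eq_weight]

theorem aDegree_nsmul (a : Fin n → ℕ) (k : ℕ) (u : Fin n →₀ ℕ) :
    aDegree a (k • u) = k * aDegree a u := by
  simp [aDegree_eq_weight]

theorem aDegree_single (a : Fin n → ℕ) (i : Fin n) (c : ℕ) :
    aDegree a (Finsupp.single i c) = c * a i := by
  simp [aDegree_eq_weight, Finsupp.weight_single]

theorem aDegree_sub_add (a : Fin n → ℕ) {u w : Fin n →₀ ℕ} (h : w ≤ u) :
    aDegree a (u - w) + aDegree a w = aDegree a u := by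
  rw [← aDegree_add, tsub_add_cancel_of_le h]

theorem aDegree_mono (a : Fin n → ℕ) {u w : Fin n →₀ ℕ} (h : w ≤ u) :
    aDegree a w ≤ aDegree a u := by
  have := aDegree_sub_add a h
  omega

theorem aDegree_erase_add (a : Fin n → ℕ) (u : Fin n →₀ ℕ) (i : Fin n) :
    aDegree a (u.erase i) + u i * a i = aDegree a u := by
  rw [← aDegree_single, ← aDegree_add, add_comm, Finsupp.single_add_erase]

theorem single_le_of_le {u : Fin n →₀ ℕ} {i : Fin n} {c : ℕ} (h : c ≤ u i) :
    Finsupp.single i c ≤ u := by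
  simpa using h

theorem aDegree_eq_zero (hpos : ∀ i, 0 < a i) {u : Fin n →₀ ℕ} (h : aDegree a u = 0) : u = 0 := by
  ext i
  have h1 := aDegree_erase_add a u i
  have h2 : u i * a i = 0 := by omega
  simpa [(hpos i).ne'] using h2

theorem eq_of_le_of_aDegree_eq (hpos : ∀ i, 0 < a i) {u w : Fin n →₀ ℕ} (h : w ≤ u)
    (hd : aDegree a w = aDegree a u) : w = u := by
  have h1 := aDegree_sub_add a h
  have h2 := aDegree_eq_zero hpos (show aDegree a (u - w) = 0 by omega)
  exact le_antisymm h (tsub_eq_zero_iff_le.mp h2)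

/-- `x^u` has no variable in common with any other monomial of the same `A`-degree. -/
def IsIsolated (a : Fin n → ℕ) (u : Fin n →₀ ℕ) : Prop :=
  ∀ w, aDegree a w = aDegree a u → ∀ i, w i ≠ 0 → u i ≠ 0 → w = u

/-- `c` is the exponent of `x_i` in the critical binomials with respect to `x_i`. -/
def IsCriticalExponent (a : Fin n → ℕ) (i : Fin n) (c : ℕ) : Prop :=
  IsLeast {c : ℕ | 0 < c ∧ c * a i ∈ AddSubmonoid.closure (a '' {j | j ≠ i})} c

theorem mem_closure_iff (i : Fin n) (x : ℕ) :
    x ∈ AddSubmonoid.closure (a '' {j | j ≠ i}) ↔ ∃ r : Fin n →₀ ℕ, r i = 0 ∧ aDegree a r = x := by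
  constructor
  · intro h
    induction h using AddSubmonoid.closure_induction with
    | mem x hx =>
      obtain ⟨j, hj, rfl⟩ := hx
      exact ⟨Finsupp.single j 1, by simpa [Finsupp.single_apply] using hj, by simp [aDegree_single]⟩
    | zero => exact ⟨0, rfl, aDegree_zero a⟩
    | add x y _ _ hx hy =>
      obtain ⟨r, hr, rfl⟩ := hx
      obtain ⟨s, hs, rfl⟩ := hy
      exact ⟨r + s, by simp [hr, hs], aDegree_add a r s⟩
  · rintro ⟨r, hr, rfl⟩
    refine sum_mem fun j _ => ?_
    by_cases hj : j = i
    · subst hj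
      simp [hr]
    · have := AddSubmonoid.nsmul_mem (AddSubmonoid.closure (a '' {j | j ≠ i}))
        (AddSubmonoid.subset_closure ⟨j, hj, rfl⟩) (r j)
      simpa using this

namespace IsCriticalExponent

variable {i : Fin n} {c : ℕ}

theorem pos (h : IsCriticalExponent a i c) : 0 < c := h.1.1

theorem exists_eq (h : IsCriticalExponent a i c) :
    ∃ r : Fin n →₀ ℕ, r i = 0 ∧ aDegree a r = c * a i :=
  (mem_closure_iff i _).mp h.1.2

theorem le (h : IsCriticalExponent a i c) {k : ℕ} (hk : 0 < k) {r : Fin n →₀ ℕ} (hr : r i = 0)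
    (hd : aDegree a r = k * a i) : c ≤ k :=
  h.2 ⟨hk, (mem_closure_iff i _).mpr ⟨r, hr, hd⟩⟩

/-- Cancelling the power of `x_i` in another monomial of this degree would write a smaller positive
multiple of `a i` without `a i`, against the minimality of `c`. -/
theorem isIsolated (hpos : ∀ i, 0 < a i) (h : IsCriticalExponent a i c) :
    IsIsolated a (Finsupp.single i c) := by
  intro w hw k hk hk'
  obtain rfl : i = k := by
    by_contra hik
    exact hk' (Finsupp.single_eq_of_ne (Ne.symm hik))
  rcases le_or_gt c (w i) with hc | hc
  · exact (eq_of_le_of_aDegree_eq hpos (single_le_of_le hc) hw.symm).symm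
  · have h1 := aDegree_erase_add a w i
    rw [hw, aDegree_single] at h1
    have h2 := h.le (k := c - w i) (by omega) (r := w.erase i) (by simp)
      (by rw [Nat.sub_mul]; omega)
    omega

end IsCriticalExponent

theorem exists_isCriticalExponent (hpos : ∀ i, 0 < a i) [Nontrivial (Fin n)] (i : Fin n) :
    ∃ c, IsCriticalExponent a i c := by
  classical
  obtain ⟨j, hj⟩ := exists_ne i
  -- The monomials `x_i ^ (a j)` and `x_j ^ (a i)` have the same degree.
  have hex : ∃ c, 0 < c ∧ c * a i ∈ AddSubmonoid.closure (a '' {j | j ≠ i}) :=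
    ⟨a j, hpos j, (mem_closure_iff i _).mpr ⟨Finsupp.single j (a i),
      by simp [hj], by rw [aDegree_single, mul_comm]⟩⟩
  exact ⟨Nat.find hex, Nat.find_spec hex, fun c hc => Nat.find_min' hex hc⟩

/-- `x^u - x^v` is a primitive binomial of the toric ideal. -/
structure IsPrimitivePair (a : Fin n → ℕ) (u v : Fin n →₀ ℕ) : Prop where
  ne : u ≠ v
  aDegree_eq : aDegree a u = aDegree a v
  eq_of_le : ∀ w z, w ≠ z → aDegree a w = aDegree a z → w ≤ u → z ≤ v → w = u ∧ z = v

namespace IsPrimitivePair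

variable {u v : Fin n →₀ ℕ}

theorem symm (h : IsPrimitivePair a u v) : IsPrimitivePair a v u where
  ne := h.ne.symm
  aDegree_eq := h.aDegree_eq.symm
  eq_of_le w z hne hd hw hz := (h.eq_of_le z w hne.symm hd.symm hz hw).symm

/-- Cancelling a common variable would give a strictly smaller binomial of the ideal. -/
theorem eq_zero_or (h : IsPrimitivePair a u v) (i : Fin n) : u i = 0 ∨ v i = 0 := by
  by_contra! hi
  have hu : Finsupp.single i 1 ≤ u := single_le_of_le (by omega)
  have hv : Finsupp.single i 1 ≤ v := single_le_of_le (by omega)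
  have h1 := aDegree_sub_add a hu
  have h2 := aDegree_sub_add a hv
  have h3 := h.eq_of_le (u - Finsupp.single i 1) (v - Finsupp.single i 1)
    (fun he => h.ne (tsub_left_inj hu hv |>.mp he)) (by have := h.aDegree_eq; omega)
    tsub_le_self tsub_le_self
  have h4 := DFunLike.congr_fun h3.1 i
  simp at h4
  omega

theorem left_ne_zero (hpos : ∀ i, 0 < a i) (h : IsPrimitivePair a u v) : u ≠ 0 := by
  rintro rfl
  exact h.ne (aDegree_eq_zero hpos (by simpa using h.aDegree_eq.symm)).symm

theorem nontrivial (hpos : ∀ i, 0 < a i) (h : IsPrimitivePair a u v) : Nontrivial (Fin n) := by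
  obtain ⟨i, hi⟩ := Finsupp.ne_iff.mp (h.left_ne_zero hpos)
  obtain ⟨j, hj⟩ := Finsupp.ne_iff.mp (h.symm.left_ne_zero hpos)
  refine ⟨i, j, ?_⟩
  rintro rfl
  rcases h.eq_zero_or i with h0 | h0
  · exact hi h0
  · exact hj h0

end IsPrimitivePair

/-- The degrees of the isolated monomials that are not alone in their degree are totally ordered
by divisibility. -/
def IsIsolatedDivisible (a : Fin n → ℕ) : Prop :=
  ∀ u v u' v', IsIsolated a u → u ≠ v → aDegree a u = aDegree a v →
    IsIsolated a u' → u' ≠ v' → aDegree a u' = aDegree a v' →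
      aDegree a u ∣ aDegree a u' ∨ aDegree a u' ∣ aDegree a u

/-! ### Consequences of divisibility: the chain of critical degrees -/

section Divisible

variable {c : Fin n → ℕ}

theorem IsCriticalExponent.exists_ne {i : Fin n} {c : ℕ} (h : IsCriticalExponent a i c) :
    ∃ v, Finsupp.single i c ≠ v ∧ aDegree a (Finsupp.single i c) = aDegree a v := by
  obtain ⟨r, hr, hd⟩ := h.exists_eq
  refine ⟨r, ?_, by rw [aDegree_single, hd]⟩
  rintro rfl
  exact h.pos.ne' (by simpa using hr)

theorem critical_dvd_or_dvd (hpos : ∀ i, 0 < a i) (hdiv : IsIsolatedDivisible a)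
    (hc : ∀ i, IsCriticalExponent a i (c i)) (i j : Fin n) :
    c i * a i ∣ c j * a j ∨ c j * a j ∣ c i * a i := by
  obtain ⟨v, hv, hdv⟩ := (hc i).exists_ne
  obtain ⟨w, hw, hdw⟩ := (hc j).exists_ne
  simpa only [aDegree_single] using
    hdiv _ v _ w ((hc i).isIsolated hpos) hv hdv ((hc j).isIsolated hpos) hw hdw

/-- A counterexample of least degree is isolated, so its degree is comparable with `c i * a i` for
any variable `x_i` it contains; both directions of divisibility contradict `s i < c i`. -/
theorem eq_of_lt_criticalExponent (hpos : ∀ i, 0 < a i) (hdiv : IsIsolatedDivisible a)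
    (hc : ∀ i, IsCriticalExponent a i (c i)) {s t : Fin n →₀ ℕ} (hs : ∀ i, s i < c i)
    (hd : aDegree a t = aDegree a s) : t = s := by
  induction hk : aDegree a s using Nat.strong_induction_on generalizing s t with
  | _ k ih =>
  by_contra hne
  -- A shared variable can be cancelled, which reduces to a smaller degree.
  have hiso : IsIsolated a s := by
    intro w hw i hwi hsi
    have hw1 : Finsupp.single i 1 ≤ w := single_le_of_le (by omega)
    have hs1 : Finsupp.single i 1 ≤ s := single_le_of_le (by omega)
    have h1 := aDegree_sub_add a hw1
    have h2 := aDegree_sub_add a hs1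
    rw [aDegree_single] at h1 h2
    have h3 := hpos i
    have h4 := ih (aDegree a (s - Finsupp.single i 1)) (by omega)
      (s := s - Finsupp.single i 1) (t := w - Finsupp.single i 1)
      (fun j => lt_of_le_of_lt (by simp) (hs j)) (by omega) rfl
    exact (tsub_left_inj hw1 hs1).mp h4
  have hs0 : s ≠ 0 := by
    rintro rfl
    exact hne (aDegree_eq_zero hpos (by simpa using hd))
  obtain ⟨i, hi⟩ := Finsupp.ne_iff.mp hs0
  rw [Finsupp.zero_apply] at hi
  have hti : t i = 0 := by
    by_contra hti
    exact hne (hiso t hd i hti hi)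
  obtain ⟨v, hv, hdv⟩ := (hc i).exists_ne
  rcases hdiv _ _ _ _ ((hc i).isIsolated hpos) hv hdv hiso (Ne.symm hne) hd.symm with ⟨q, hq⟩ | ⟨q, hq⟩
  · rw [aDegree_single] at hq
    have hq0 : q ≠ 0 := by
      rintro rfl
      exact hs0 (aDegree_eq_zero hpos (by simpa using hq))
    -- A power of `x_i ^ (c i)` has the degree of `s` and shares `x_i` with it, so it equals `s`.
    have h1 := hiso (Finsupp.single i (q * c i)) (by rw [aDegree_single, hq]; ring) i
      (by simpa using ⟨hq0, (hc i).pos.ne'⟩) hi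
    have h2 := hs i
    rw [← h1, Finsupp.single_eq_same] at h2
    have := Nat.le_mul_of_pos_left (c i) (Nat.pos_of_ne_zero hq0)
    omega
  · have hq0 : q ≠ 0 := by
      rintro rfl
      rw [aDegree_single, mul_zero] at hq
      exact (Nat.mul_pos (hc i).pos (hpos i)).ne' hq
    -- Now a multiple of `s` has the degree of the isolated monomial `x_i ^ (c i)`, so `s` is a
    -- power of `x_i`. As `t` avoids `x_i`, minimality of `c i` gives `c i ≤ s i`.
    have h1 := (hc i).isIsolated hpos (q • s) (by rw [aDegree_nsmul, hq, mul_comm]) i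
      (by simpa using ⟨hq0, hi⟩) (by simpa using (hc i).pos.ne')
    have h2 : s = Finsupp.single i (s i) := by
      ext j
      by_cases hj : j = i
      · simp [hj]
      · have h3 := DFunLike.congr_fun h1 j
        rw [Finsupp.single_eq_of_ne hj] at h3 ⊢
        simpa [hq0] using h3
    have h3 := (hc i).le (Nat.pos_of_ne_zero hi) hti (by rw [hd, h2, aDegree_single]; simp)
    exact absurd (hs i) (by omega)

/-- Entrywise remainder modulo the critical exponents. -/
noncomputable def remainder (c : Fin n → ℕ) (u : Fin n →₀ ℕ) : Fin n →₀ ℕ :=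
  Finsupp.equivFunOnFinite.symm fun i => u i % c i

theorem exists_forall_dvd {ι : Type*} (s : Finset ι) (hs : s.Nonempty) (h : ι → ℕ)
    (hpos : ∀ i ∈ s, 0 < h i) (hdiv : ∀ i ∈ s, ∀ j ∈ s, h i ∣ h j ∨ h j ∣ h i) :
    ∃ i ∈ s, ∀ j ∈ s, h i ∣ h j := by
  obtain ⟨i, hi, hmin⟩ := s.exists_min_image h hs
  refine ⟨i, hi, fun j hj => ?_⟩
  rcases hdiv i hi j hj with h1 | h1
  · exact h1
  · rw [le_antisymm (hmin j hj) (Nat.le_of_dvd (hpos i hi) h1)]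

theorem exists_aDegree_eq_remainder_add {d : ℕ} (hd : ∀ i, d ∣ c i * a i) (u : Fin n →₀ ℕ) :
    ∃ k, aDegree a u = aDegree a (remainder c u) + k * d := by
  have h : d ∣ ∑ i, u i / c i * (c i * a i) := Finset.dvd_sum fun i _ => (hd i).mul_left _
  obtain ⟨k, hk⟩ := h
  refine ⟨k, ?_⟩
  rw [mul_comm, ← hk, aDegree, aDegree, ← Finset.sum_add_distrib]
  refine Finset.sum_congr rfl fun i _ => ?_
  change _ = u i % c i * a i + _
  conv_lhs => rw [← Nat.mod_add_div (u i) (c i)]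
  ring

/-- The surplus `k - l` can be realised as a power of `x_i ^ (c i)`. Uniqueness of the monomial
`remainder c v` in its degree then forces the surplus to vanish. -/
theorem remainder_eq_of_le (hpos : ∀ i, 0 < a i) (hdiv : IsIsolatedDivisible a)
    (hc : ∀ i, IsCriticalExponent a i (c i)) {i : Fin n} {u v : Fin n →₀ ℕ} {k l : ℕ}
    (h : aDegree a (remainder c u) + k * (c i * a i) =
      aDegree a (remainder c v) + l * (c i * a i)) (hkl : l ≤ k) :
    remainder c u = remainder c v := by
  obtain ⟨q, rfl⟩ := Nat.exists_eq_add_of_le hkl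
  have hlt : ∀ (w : Fin n →₀ ℕ) j, remainder c w j < c j := fun w j => Nat.mod_lt _ (hc j).pos
  have h1 : remainder c u + Finsupp.single i (q * c i) = remainder c v :=
    eq_of_lt_criticalExponent hpos hdiv hc (hlt v) (by
      rw [aDegree_add, aDegree_single]
      linarith)
  have h2 := DFunLike.congr_fun h1 i
  have h3 := hlt v i
  rcases Nat.eq_zero_or_pos q with rfl | hq
  · simpa using h1
  · rw [Finsupp.add_apply, Finsupp.single_eq_same] at h2
    have := Nat.le_mul_of_pos_left (c i) hq
    omega

/-- The least critical degree divides all the others, so the two remainders have congruent degrees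
and hence agree. Because the supports are disjoint, one of two equal residues is zero at each index.
-/
theorem IsPrimitivePair.dvd_left (hpos : ∀ i, 0 < a i) (hdiv : IsIsolatedDivisible a)
    (hc : ∀ i, IsCriticalExponent a i (c i)) {u v : Fin n →₀ ℕ} (h : IsPrimitivePair a u v)
    (i : Fin n) : c i ∣ u i := by
  obtain ⟨j, -, hj⟩ := exists_forall_dvd Finset.univ ⟨i, Finset.mem_univ i⟩ (fun i => c i * a i)
    (fun i _ => Nat.mul_pos (hc i).pos (hpos i))
    (fun i _ j _ => critical_dvd_or_dvd hpos hdiv hc i j)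
  obtain ⟨k, hk⟩ := exists_aDegree_eq_remainder_add (fun i => hj i (Finset.mem_univ i)) u
  obtain ⟨l, hl⟩ := exists_aDegree_eq_remainder_add (fun i => hj i (Finset.mem_univ i)) v
  have hkl := h.aDegree_eq
  rw [hk, hl] at hkl
  have heq : remainder c u = remainder c v := by
    rcases le_total l k with hle | hle
    · exact remainder_eq_of_le hpos hdiv hc hkl hle
    · exact (remainder_eq_of_le hpos hdiv hc hkl.symm hle).symm
  have h1 : u i % c i = v i % c i := DFunLike.congr_fun heq i
  rcases h.eq_zero_or i with h0 | h0
  · simp [h0]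
  · exact Nat.dvd_of_mod_eq_zero (by simpa [h0] using h1)

theorem dvd_aDegree {d : ℕ} {u : Fin n →₀ ℕ} (hu : ∀ i, c i ∣ u i)
    (hd : ∀ i ∈ u.support, d ∣ c i * a i) : d ∣ aDegree a u := by
  refine Finset.dvd_sum fun i _ => ?_
  by_cases hi : u i = 0
  · simp [hi]
  · exact (hd i (by simpa using hi)).trans (mul_dvd_mul_right (hu i) _)

/-- Paying `T` exactly with coins `c i * a i`: discard the smallest coin until the total is `T`. -/
theorem exists_le_aDegree_eq (hpos : ∀ i, 0 < a i) (hc : ∀ i, 0 < c i)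
    (hdiv : ∀ i j, c i * a i ∣ c j * a j ∨ c j * a j ∣ c i * a i) {T : ℕ} {u : Fin n →₀ ℕ}
    (hu : ∀ i, c i ∣ u i) (hT : ∀ i ∈ u.support, c i * a i ∣ T) (hle : T ≤ aDegree a u) :
    ∃ w ≤ u, aDegree a w = T := by
  induction hk : aDegree a u using Nat.strong_induction_on generalizing u with
  | _ k ih =>
  rcases hle.eq_or_lt with he | hlt
  · exact ⟨u, le_rfl, he.symm⟩
  have hu0 : u.support.Nonempty := by
    rw [Finsupp.support_nonempty_iff]
    rintro rfl
    simp at hlt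
  obtain ⟨i, hi, hmin⟩ := exists_forall_dvd u.support hu0 (fun i => c i * a i)
    (fun i _ => Nat.mul_pos (hc i) (hpos i)) (fun i _ j _ => hdiv i j)
  -- The smallest coin divides both the total and `T`, so a positive excess is at least one such
  -- coin.
  have h1 : c i * a i ∣ aDegree a u - T := Nat.dvd_sub (dvd_aDegree hu hmin) (hT i hi)
  have h2 := Nat.le_of_dvd (by omega) h1
  have h3 : Finsupp.single i (c i) ≤ u :=
    single_le_of_le (Nat.le_of_dvd (Nat.pos_of_ne_zero (by simpa using hi)) (hu i))
  have h4 := aDegree_sub_add a h3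
  rw [aDegree_single] at h4
  have h5 := Nat.mul_pos (hc i) (hpos i)
  obtain ⟨w, hw, hdw⟩ := ih (aDegree a (u - Finsupp.single i (c i))) (by omega)
    (u := u - Finsupp.single i (c i))
    (fun j => by
      rw [Finsupp.tsub_apply]
      by_cases hj : j = i
      · subst hj
        rw [Finsupp.single_eq_same]
        exact Nat.dvd_sub (hu j) dvd_rfl
      · simpa [Finsupp.single_eq_of_ne hj] using hu j)
    (fun j hj => hT j (Finsupp.support_tsub hj)) (by omega) rfl
  exact ⟨w, hw.trans tsub_le_self, hdw⟩

/-- The power `x_j ^ (c j)` divides `x^v`, and by the coin argument `x^u` has a divisor of the same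
degree; primitivity leaves no room for anything more. -/
theorem IsPrimitivePair.eq_single_of_forall_dvd (hpos : ∀ i, 0 < a i)
    (hdiv : IsIsolatedDivisible a) (hc : ∀ i, IsCriticalExponent a i (c i))
    {u v : Fin n →₀ ℕ} (h : IsPrimitivePair a u v) {j : Fin n} (hj : v j ≠ 0)
    (hmax : ∀ i ∈ u.support, c i * a i ∣ c j * a j) : v = Finsupp.single j (c j) := by
  have hle : Finsupp.single j (c j) ≤ v := single_le_of_le
    (Nat.le_of_dvd (Nat.pos_of_ne_zero hj) (h.symm.dvd_left hpos hdiv hc j))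
  have hd := aDegree_mono a hle
  rw [aDegree_single, ← h.aDegree_eq] at hd
  obtain ⟨w, hw, hdw⟩ := exists_le_aDegree_eq hpos (fun i => (hc i).pos)
    (critical_dvd_or_dvd hpos hdiv hc) (h.dvd_left hpos hdiv hc) hmax hd
  refine (h.eq_of_le w (Finsupp.single j (c j)) ?_ (by rw [hdw, aDegree_single]) hw hle).2.symm
  rintro rfl
  have h1 := hw j
  rw [Finsupp.single_eq_same] at h1
  have := (hc j).pos
  rcases h.eq_zero_or j with h0 | h0
  · omega
  · exact hj h0

theorem exists_forall_dvd_max {ι : Type*} (s : Finset ι) (hs : s.Nonempty) (h : ι → ℕ)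
    (hpos : ∀ i ∈ s, 0 < h i) (hdiv : ∀ i ∈ s, ∀ j ∈ s, h i ∣ h j ∨ h j ∣ h i) :
    ∃ i ∈ s, ∀ j ∈ s, h j ∣ h i := by
  obtain ⟨i, hi, hmax⟩ := s.exists_max_image h hs
  refine ⟨i, hi, fun j hj => ?_⟩
  rcases hdiv i hi j hj with h1 | h1
  · rw [le_antisymm (hmax j hj) (Nat.le_of_dvd (hpos j hj) h1)]
  · exact h1

theorem IsPrimitivePair.exists_eq_single (hpos : ∀ i, 0 < a i)
    (hdiv : IsIsolatedDivisible a) (hc : ∀ i, IsCriticalExponent a i (c i))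
    {u v : Fin n →₀ ℕ} (h : IsPrimitivePair a u v) :
    ∃ j, u = Finsupp.single j (c j) ∨ v = Finsupp.single j (c j) := by
  classical
  have hne : (u.support ∪ v.support).Nonempty :=
    (Finsupp.support_nonempty_iff.mpr (h.left_ne_zero hpos)).mono Finset.subset_union_left
  obtain ⟨j, hj, hmax⟩ := exists_forall_dvd_max _ hne (fun i => c i * a i)
    (fun i _ => Nat.mul_pos (hc i).pos (hpos i))
    (fun i _ j _ => critical_dvd_or_dvd hpos hdiv hc i j)
  rcases Finset.mem_union.mp hj with hj | hj
  · exact ⟨j, .inl (h.symm.eq_single_of_forall_dvd hpos hdiv hc (by simpa using hj)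
      fun i hi => hmax i (Finset.mem_union_right _ hi))⟩
  · exact ⟨j, .inr (h.eq_single_of_forall_dvd hpos hdiv hc (by simpa using hj)
      fun i hi => hmax i (Finset.mem_union_left _ hi))⟩

/-- If the degree of `x^r` is that of a critical power `x_j ^ c_j` and all exponents of `r` are
multiples of the critical ones, then either `x^r` is a pure power or it has two distinct proper
divisors of the same degree. -/
theorem exists_proper_divisors (hpos : ∀ i, 0 < a i)
    (hdiv : IsIsolatedDivisible a) (hc : ∀ i, IsCriticalExponent a i (c i))
    {r : Fin n →₀ ℕ} (hr : ∀ i, c i ∣ r i) {j : Fin n} (hd : aDegree a r = c j * a j)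
    {i k : Fin n} (hi : r i ≠ 0) (hk : r k ≠ 0) (hik : i ≠ k) :
    ∃ w z, w ≠ z ∧ aDegree a w = aDegree a z ∧ w ≤ r ∧ z ≤ r ∧ w ≠ r ∧ z ≠ r := by
  have hchain := critical_dvd_or_dvd hpos hdiv hc
  have hcpos : ∀ i, 0 < c i * a i := fun i => Nat.mul_pos (hc i).pos (hpos i)
  -- `p` carries the smallest coin in `r`, and `q` below the smallest coin among the remaining
  -- variables.
  obtain ⟨p, hp, hpmin⟩ := exists_forall_dvd r.support ⟨i, by simpa using hi⟩ (fun i => c i * a i)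
    (fun i _ => hcpos i) (fun i _ j _ => hchain i j)
  have hne : (r.erase p).support.Nonempty := by
    rw [Finsupp.support_erase]
    by_cases hpi : i = p
    · exact ⟨k, by simpa using ⟨fun h => hik (hpi.trans h.symm), hk⟩⟩
    · exact ⟨i, by simpa using ⟨hpi, hi⟩⟩
  obtain ⟨q, hq, hqmin⟩ := exists_forall_dvd (r.erase p).support hne (fun i => c i * a i)
    (fun i _ => hcpos i) (fun i _ j _ => hchain i j)
  have hq' : q ≠ p ∧ r q ≠ 0 := by simpa [Finsupp.support_erase] using hq
  have hp' : r p ≠ 0 := by simpa using hp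
  have hrp : ∀ i, c i ∣ r.erase p i := fun i => by
    by_cases h : i = p
    · simp [h]
    · simpa [Finsupp.erase_ne h] using hr i
  have hcq : c q ≤ r q := Nat.le_of_dvd (Nat.pos_of_ne_zero hq'.2) (hr q)
  -- If the chain runs the other way, the two coins are equal, since coin `q` is at most the total
  -- degree.
  have h1 : c q * a q ∣ aDegree a r := by
    rw [hd]
    rcases hchain q j with h | h
    · exact h
    · have h2 := aDegree_mono a (single_le_of_le hcq)
      rw [hd, aDegree_single] at h2
      rw [le_antisymm h2 (Nat.le_of_dvd (hcpos q) h)]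
  -- Coin `q` divides the total and the contribution of every variable other than `x_p`. So `x_p`
  -- contributes at least one coin `q`, which can be paid by `t` coins `p`.
  have h2 : c q * a q ∣ r p * a p := by
    rw [← aDegree_erase_add a r p] at h1
    exact (Nat.dvd_add_right (dvd_aDegree hrp hqmin)).mp h1
  have h3 := Nat.le_of_dvd (Nat.mul_pos (Nat.pos_of_ne_zero hp') (hpos p)) h2
  obtain ⟨t, ht⟩ := hpmin q (by simpa using hq'.2)
  have h4 : t * c p ≤ r p := Nat.le_of_mul_le_mul_right (by linarith) (hpos p)
  refine ⟨Finsupp.single p (t * c p), Finsupp.single q (c q), fun h => ?_, ?_,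
    single_le_of_le h4, single_le_of_le hcq, fun h => ?_, fun h => ?_⟩
  · have := DFunLike.congr_fun h q
    rw [Finsupp.single_eq_of_ne hq'.1, Finsupp.single_eq_same] at this
    exact (hc q).pos.ne this
  · rw [aDegree_single, aDegree_single, ht]
    ring
  · have := DFunLike.congr_fun h q
    rw [Finsupp.single_eq_of_ne hq'.1] at this
    exact hq'.2 this.symm
  · have := DFunLike.congr_fun h p
    rw [Finsupp.single_eq_of_ne hq'.1.symm] at this
    exact hp' this.symm

end Divisible

end Combinatorics

/-! ### Markov bases, the Graver basis and critical binomials -/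

section MarkovBases

open MvPolynomial

variable {n : ℕ} {a : Fin n → ℕ} {K : Type*} [Field K]

theorem coeff_binom (u v t : Fin n →₀ ℕ) :
    coeff t (binom K u v) = (if u = t then 1 else 0) - (if v = t then 1 else 0) := by
  simp [binom, coeff_monomial]

theorem neg_binom (u v : Fin n →₀ ℕ) : -binom K u v = binom K v u := neg_sub _ _

theorem binom_self (u : Fin n →₀ ℕ) : binom K u u = 0 := sub_self _

theorem coeff_binom_left {u v : Fin n →₀ ℕ} (h : u ≠ v) : coeff u (binom K u v) = 1 := by
  simp [coeff_binom, h.symm]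

theorem eq_or_eq_of_mem_support_binom {u v t : Fin n →₀ ℕ} (h : t ∈ (binom K u v).support) :
    t = u ∨ t = v := by
  by_contra! ht
  simp [mem_support_iff, coeff_binom, ht.1.symm, ht.2.symm] at h

theorem monomial_mul_binom (w u v : Fin n →₀ ℕ) :
    monomial w (1 : K) * binom K u v = binom K (w + u) (w + v) := by
  simp [binom, mul_sub, monomial_mul]

theorem binom_add_binom (u v w : Fin n →₀ ℕ) : binom K u v + binom K v w = binom K u w := by
  simp [binom]

theorem binom_mem_toricIdeal {u v : Fin n →₀ ℕ} (h : aDegree a u = aDegree a v) :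
    binom K u v ∈ toricIdeal K a :=
  Ideal.subset_span ⟨u, v, h, rfl⟩

/-- The parametrization `x_i ↦ t^(a_i)`, whose kernel contains the toric ideal. -/
noncomputable def toricMap (K : Type*) [Field K] (a : Fin n → ℕ) :
    MvPolynomial (Fin n) K →ₐ[K] Polynomial K :=
  aeval fun i => Polynomial.X ^ a i

theorem toricMap_monomial (u : Fin n →₀ ℕ) (c : K) :
    toricMap K a (monomial u c) = Polynomial.monomial (aDegree a u) c := by
  rw [toricMap, aeval_monomial, Finsupp.prod_fintype _ _ (by simp)]
  simp_rw [← pow_mul, Finset.prod_pow_eq_pow_sum]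
  rw [← Polynomial.C_mul_X_pow_eq_monomial, aDegree]
  simp [mul_comm]

theorem toricMap_eq_zero {g : MvPolynomial (Fin n) K} (hg : g ∈ toricIdeal K a) :
    toricMap K a g = 0 := by
  have h : toricIdeal K a ≤ RingHom.ker (toricMap K a) := by
    rw [toricIdeal, Ideal.span_le]
    rintro _ ⟨u, v, huv, rfl⟩
    simp [binom, RingHom.mem_ker, toricMap_monomial, huv]
  exact h hg

/-- Under `toricMap` the term at `u` must cancel, and only terms of the same degree can cancel it.
-/
theorem exists_mem_support_ne {g : MvPolynomial (Fin n) K} (hg : g ∈ toricIdeal K a)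
    {u : Fin n →₀ ℕ} (hu : u ∈ g.support) :
    ∃ t ∈ g.support, t ≠ u ∧ aDegree a t = aDegree a u := by
  by_contra! h
  have h0 := congrArg (fun p => Polynomial.coeff p (aDegree a u)) (toricMap_eq_zero hg)
  simp only [Polynomial.coeff_zero] at h0
  rw [g.as_sum, map_sum, Polynomial.finsetSum_coeff, Finset.sum_eq_single_of_mem u hu] at h0
  · rw [toricMap_monomial, Polynomial.coeff_monomial_same] at h0
    exact (mem_support_iff.mp hu) h0
  · intro t ht htu
    rw [toricMap_monomial, Polynomial.coeff_monomial_of_ne _ (h t ht htu).symm]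

theorem binom_mem_toricIdeal_iff {u v : Fin n →₀ ℕ} :
    binom K u v ∈ toricIdeal K a ↔ aDegree a u = aDegree a v := by
  refine ⟨fun h => ?_, binom_mem_toricIdeal⟩
  by_cases huv : u = v
  · rw [huv]
  obtain ⟨t, ht, htu, hd⟩ := exists_mem_support_ne h (u := u)
    (by simp [mem_support_iff, coeff_binom_left huv])
  rcases eq_or_eq_of_mem_support_binom ht with rfl | rfl
  · exact absurd rfl htu
  · exact hd.symm

theorem mem_graverBasis_iff {f : MvPolynomial (Fin n) K} :
    f ∈ graverBasis K a ↔ ∃ u v, f = binom K u v ∧ IsPrimitivePair a u v := by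
  simp only [graverBasis, Set.mem_ofPred_eq, binom_mem_toricIdeal_iff]
  exact ⟨fun ⟨u, v, hf, h1, h2, h3⟩ => ⟨u, v, hf, h1, h2, h3⟩,
    fun ⟨u, v, hf, h⟩ => ⟨u, v, hf, h.ne, h.aDegree_eq, h.eq_of_le⟩⟩

theorem coeff_mul_binom_eq_zero {u p q : Fin n →₀ ℕ} (hu : IsIsolated a u) (hp : p ≠ u)
    (hq : q ≠ u) (hd : aDegree a p = aDegree a q) (r : MvPolynomial (Fin n) K) :
    coeff u (r * binom K p q) = 0 := by
  -- If `x^p` properly divides `x^u`, then replacing `p` by `q` inside `u` keeps both the degree and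
  -- a variable, so isolation gives `p = q`.
  have key : ∀ {p q : Fin n →₀ ℕ}, p ≠ u → aDegree a p = aDegree a q → p ≤ u → p = q := by
    intro p q hp hd hle
    obtain ⟨i, hi⟩ : ∃ i, p i < u i := by
      by_contra! h
      exact hp (le_antisymm hle h)
    have h1 := aDegree_sub_add a hle
    have h2 : u - p + q = u := hu _ (by rw [aDegree_add]; omega) i
      (by rw [Finsupp.add_apply, Finsupp.tsub_apply]; omega) (by omega)
    have h3 : u - p + p = u := tsub_add_cancel_of_le hle
    exact add_left_cancel (h3.trans h2.symm)
  by_cases hpu : p ≤ u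
  · rw [key hp hd hpu, binom_self, mul_zero, coeff_zero]
  by_cases hqu : q ≤ u
  · rw [key hq hd.symm hqu, binom_self, mul_zero, coeff_zero]
  simp [binom, mul_sub, coeff_mul_monomial', hpu, hqu]

theorem coeff_eq_zero_of_mem_span {u : Fin n →₀ ℕ} (hu : IsIsolated a u)
    {B : Set (MvPolynomial (Fin n) K)}
    (hB : ∀ f ∈ B, ∃ p q, p ≠ u ∧ q ≠ u ∧ aDegree a p = aDegree a q ∧ f = binom K p q)
    {g : MvPolynomial (Fin n) K} (hg : g ∈ Ideal.span B) : coeff u g = 0 := by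
  suffices ∀ r, coeff u (r * g) = 0 by simpa using this 1
  refine Submodule.span_induction (p := fun x _ => ∀ r, coeff u (r * x) = 0) ?_ ?_ ?_ ?_ hg
  · intro f hf r
    obtain ⟨p, q, hp, hq, hd, rfl⟩ := hB f hf
    exact coeff_mul_binom_eq_zero hu hp hq hd r
  · simp
  · intro x y _ _ hx hy r
    rw [mul_add, coeff_add, hx, hy, add_zero]
  · intro s x _ hx r
    rw [smul_eq_mul, ← mul_assoc]
    exact hx _

theorem exists_minimal_generating_subset {R : Type*} [CommRing R] [IsNoetherianRing R]
    {I : Ideal R} {B : Set R} (hB : Ideal.span B = I) :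
    ∃ B' ⊆ B, Ideal.span B' = I ∧ ∀ B'' : Set R, B'' ⊂ B' → Ideal.span B'' ≠ I := by
  classical
  obtain ⟨s, hs, hspan⟩ := (Submodule.fg_span_iff_fg_span_finset_subset B).mp
    (IsNoetherian.noetherian (Ideal.span B))
  have hne : {t : Finset R | (t : Set R) ⊆ B ∧ Ideal.span (t : Set R) = I}.Nonempty :=
    ⟨s, hs, hspan.symm.trans hB⟩
  obtain ⟨t, ⟨htB, htI⟩, hmin⟩ := WellFounded.has_min (wellFounded_lt (α := Finset R)) _ hne
  refine ⟨t, htB, htI, fun B'' hlt hspan' => ?_⟩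
  lift B'' to Finset R using t.finite_toSet.subset hlt.subset
  exact hmin B'' ⟨hlt.subset.trans htB, hspan'⟩ (Finset.coe_ssubset.mp hlt)

/-- The binomials of the ideal avoiding `x^u`, together with `x^u - x^v`, generate it. Pruning
cannot remove the latter, because every element generated by the former has zero coefficient at the
isolated monomial `x^u`. -/
theorem exists_isMarkovBasis {u v : Fin n →₀ ℕ} (hu : IsIsolated a u) (huv : u ≠ v)
    (hd : aDegree a u = aDegree a v) :
    ∃ B, IsMarkovBasis K a B ∧ binom K u v ∈ B := by
  set B : Set (MvPolynomial (Fin n) K) :=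
    {f | ∃ p q, p ≠ u ∧ q ≠ u ∧ aDegree a p = aDegree a q ∧ f = binom K p q} with hBdef
  have hspan : Ideal.span (insert (binom K u v) B) = toricIdeal K a := by
    apply le_antisymm
    · rw [Ideal.span_le]
      rintro f (rfl | ⟨p, q, -, -, hpq, rfl⟩)
      · exact binom_mem_toricIdeal hd
      · exact binom_mem_toricIdeal hpq
    · have hleft : ∀ q, q ≠ u → aDegree a u = aDegree a q →
          binom K u q ∈ Ideal.span (insert (binom K u v) B) := by
        intro q hq hdq
        rw [← binom_add_binom u v q]
        exact add_mem (Ideal.subset_span (Set.mem_insert _ _))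
          (Ideal.subset_span (Set.mem_insert_of_mem _
            ⟨v, q, huv.symm, hq, hd.symm.trans hdq, rfl⟩))
      rw [toricIdeal, Ideal.span_le]
      rintro f ⟨p, q, hpq, rfl⟩
      by_cases hp : p = u
      · subst hp
        by_cases hq : q = p
        · rw [hq, binom_self]
          exact zero_mem _
        · exact hleft q hq hpq
      · by_cases hq : q = u
        · subst hq
          simpa only [neg_binom, SetLike.mem_coe] using neg_mem (hleft p hp hpq.symm)
        · exact Ideal.subset_span (Set.mem_insert_of_mem _ ⟨p, q, hp, hq, hpq, rfl⟩)
  obtain ⟨B', hB', hspan', hmin⟩ := exists_minimal_generating_subset hspan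
  refine ⟨B', ⟨fun f hf => ?_, hspan', hmin⟩, ?_⟩
  · rcases hB' hf with rfl | ⟨p, q, -, -, -, rfl⟩
    · exact ⟨u, v, rfl⟩
    · exact ⟨p, q, rfl⟩
  · by_contra hf
    have hsub : B' ⊆ B := fun g hg => (hB' hg).resolve_left fun h => hf (h ▸ hg)
    have h0 : coeff u (binom K u v) = 0 :=
      coeff_eq_zero_of_mem_span hu (B := B') (fun g hg => hsub hg) (hspan' ▸ binom_mem_toricIdeal hd)
    rw [coeff_binom_left huv] at h0
    exact one_ne_zero h0

open scoped Pointwise in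
theorem IsMarkovBasis.neg {B : Set (MvPolynomial (Fin n) K)} (h : IsMarkovBasis K a B) :
    IsMarkovBasis K a (-B) := by
  have hspan : ∀ s : Set (MvPolynomial (Fin n) K), Ideal.span (-s) = Ideal.span s :=
    fun s => Submodule.span_neg s
  refine ⟨fun f hf => ?_, by rw [hspan, h.2.1], fun B' hB' => ?_⟩
  · obtain ⟨u, v, huv⟩ := h.1 _ hf
    exact ⟨v, u, by rw [← neg_binom, ← huv, neg_neg]⟩
  · rw [← hspan]
    exact h.2.2 _ ⟨Set.neg_subset.mpr hB'.1, fun hB => hB'.2 (Set.neg_subset.mpr hB)⟩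

theorem neg_mem_universalMarkovBasis {f : MvPolynomial (Fin n) K}
    (h : f ∈ universalMarkovBasis K a) : -f ∈ universalMarkovBasis K a := by
  obtain ⟨B, hB, hf⟩ := h
  exact ⟨_, hB.neg, by simpa using hf⟩

theorem isIsolatedDivisible_of_isBettiDivisible (h : IsBettiDivisible K a) :
    IsIsolatedDivisible a := by
  intro u v u' v' hu huv hd hu' huv' hd'
  obtain ⟨B, hB, hmem⟩ := exists_isMarkovBasis (K := K) hu huv hd
  obtain ⟨B', hB', hmem'⟩ := exists_isMarkovBasis (K := K) hu' huv' hd'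
  exact h _ ⟨B, hB, u, v, hmem, rfl⟩ _ ⟨B', hB', u', v', hmem', rfl⟩

theorem binom_mem_universalMarkovBasis (hpos : ∀ i, 0 < a i) {i : Fin n} {c : ℕ}
    (hc : IsCriticalExponent a i c) {r : Fin n →₀ ℕ} (hr : r i = 0)
    (hd : c * a i = aDegree a r) :
    binom K (Finsupp.single i c) r ∈ universalMarkovBasis K a := by
  refine exists_isMarkovBasis (hc.isIsolated hpos) ?_ (by rw [aDegree_single, hd])
  rintro rfl
  exact hc.pos.ne' (by simpa using hr)

theorem criticalBinomials_subset_universalMarkovBasis (hpos : ∀ i, 0 < a i) :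
    criticalBinomials K a ⊆ universalMarkovBasis K a := by
  have key : ∀ i f, IsCriticalBinomial K a i f → f ∈ universalMarkovBasis K a := by
    rintro i f ⟨c, r, hc, hr, hd, rfl⟩
    exact binom_mem_universalMarkovBasis hpos hc hr hd
  rintro f ⟨i, h | h⟩
  · exact key i f h
  · simpa using neg_mem_universalMarkovBasis (key i _ h)

theorem isWeightedHomogeneous_binom {u v : Fin n →₀ ℕ} {d : ℕ} (hu : aDegree a u = d)
    (hv : aDegree a v = d) : IsWeightedHomogeneous a (binom K u v) d :=
  (isWeightedHomogeneous_monomial a u 1 (by rw [← aDegree_eq_weight, hu])).sub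
    (isWeightedHomogeneous_monomial a v 1 (by rw [← aDegree_eq_weight, hv]))

theorem weightedHomogeneousComponent_mul_eq_zero {d e : ℕ} (hlt : e < d)
    {f : MvPolynomial (Fin n) K} (hf : IsWeightedHomogeneous a f d)
    (r : MvPolynomial (Fin n) K) : weightedHomogeneousComponent a e (r * f) = 0 := by
  classical
  induction r using MvPolynomial.induction_on' with
  | monomial u c =>
    have h := (isWeightedHomogeneous_monomial a u c rfl).mul hf
    exact h.weightedHomogeneousComponent_ne _ (by omega)
  | add p q hp hq => rw [add_mul, map_add, hp, hq, add_zero]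

theorem weightedHomogeneousComponent_mul_mem {e : ℕ} {J : Ideal (MvPolynomial (Fin n) K)}
    {f : MvPolynomial (Fin n) K} {d : ℕ} (hf : IsWeightedHomogeneous a f d) (hJ : f ∈ J)
    (r : MvPolynomial (Fin n) K) : weightedHomogeneousComponent a e (r * f) ∈ J := by
  classical
  induction r using MvPolynomial.induction_on' with
  | monomial u c =>
    have h := (isWeightedHomogeneous_monomial a u c rfl).mul hf
    by_cases he : Finsupp.weight a u + d = e
    · subst he
      rw [h.weightedHomogeneousComponent_same]
      exact J.mul_mem_left _ hJ
    · rw [h.weightedHomogeneousComponent_ne _ (by omega)]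
      exact zero_mem _
  | add p q hp hq =>
    rw [add_mul, map_add]
    exact add_mem hp hq

/-- In the degree-`e` component of a combination of generators, the multiples of `f` contribute
nothing because `e < d`. -/
theorem mem_span_diff_of_isWeightedHomogeneous {B : Set (MvPolynomial (Fin n) K)}
    (hB : ∀ b ∈ B, ∃ d, IsWeightedHomogeneous a b d) {f : MvPolynomial (Fin n) K} {d e : ℕ}
    (hf : IsWeightedHomogeneous a f d) (hlt : e < d) {g : MvPolynomial (Fin n) K}
    (hg : IsWeightedHomogeneous a g e) (hmem : g ∈ Ideal.span B) :
    g ∈ Ideal.span (B \ {f}) := by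
  classical
  rw [← hg.weightedHomogeneousComponent_same]
  suffices ∀ r, weightedHomogeneousComponent a e (r * g) ∈ Ideal.span (B \ {f}) by
    simpa using this 1
  refine Submodule.span_induction
    (p := fun x _ => ∀ r, weightedHomogeneousComponent a e (r * x) ∈ Ideal.span (B \ {f}))
    ?_ ?_ ?_ ?_ hmem
  · intro b hb r
    by_cases hbf : b = f
    · rw [hbf, weightedHomogeneousComponent_mul_eq_zero hlt hf]
      exact zero_mem _
    · obtain ⟨d', hd'⟩ := hB b hb
      have hb' : b ∈ Ideal.span (B \ {f}) := Ideal.subset_span ⟨hb, hbf⟩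
      exact weightedHomogeneousComponent_mul_mem hd' hb' r
  · simp
  · intro x y _ _ hx hy r
    rw [mul_add, map_add]
    exact add_mem (hx r) (hy r)
  · intro s x _ hx r
    rw [smul_eq_mul, ← mul_assoc]
    exact hx _

/-- A non-primitive binomial is a combination of binomials of smaller degree, which the other
elements of the basis already generate. -/
theorem IsMarkovBasis.isPrimitivePair (hpos : ∀ i, 0 < a i) {B : Set (MvPolynomial (Fin n) K)}
    (hB : IsMarkovBasis K a B) {u v : Fin n →₀ ℕ} (hf : binom K u v ∈ B) :
    IsPrimitivePair a u v := by
  have hmemI : ∀ g ∈ B, g ∈ toricIdeal K a := fun g hg => hB.2.1 ▸ Ideal.subset_span hg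
  have hnot : binom K u v ∉ Ideal.span (B \ {binom K u v}) := by
    intro h
    refine hB.2.2 (B \ {binom K u v}) (Set.sdiff_singleton_ssubset.mpr hf) ?_
    rw [← hB.2.1]
    refine le_antisymm (Ideal.span_mono Set.sdiff_subset) (Ideal.span_le.mpr fun g hg => ?_)
    by_cases hgf : g = binom K u v
    · rw [hgf]
      exact h
    · exact Ideal.subset_span ⟨hg, hgf⟩
  have hd : aDegree a u = aDegree a v := binom_mem_toricIdeal_iff.mp (hmemI _ hf)
  refine ⟨fun h => hnot ?_, hd, fun w z hwz hdwz hw hz => ?_⟩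
  · rw [h, binom_self]
    exact zero_mem _
  by_contra hcon
  have hhom : ∀ b ∈ B, ∃ d, IsWeightedHomogeneous a b d := by
    intro b hb
    obtain ⟨p, q, rfl⟩ := hB.1 b hb
    exact ⟨_, isWeightedHomogeneous_binom (binom_mem_toricIdeal_iff.mp (hmemI _ hb)) rfl⟩
  have hlow : ∀ p q, aDegree a p = aDegree a q → aDegree a p < aDegree a u →
      binom K p q ∈ Ideal.span (B \ {binom K u v}) := fun p q hpq hlt =>
    mem_span_diff_of_isWeightedHomogeneous hhom (isWeightedHomogeneous_binom rfl hd.symm) hlt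
      (isWeightedHomogeneous_binom rfl hpq.symm) (hB.2.1 ▸ binom_mem_toricIdeal hpq)
  have hw' := aDegree_sub_add a hw
  have hz' := aDegree_sub_add a hz
  have hlt : aDegree a w < aDegree a u := by
    refine lt_of_le_of_ne (aDegree_mono a hw) fun h => hcon ⟨?_, ?_⟩
    · exact eq_of_le_of_aDegree_eq hpos hw h
    · exact eq_of_le_of_aDegree_eq hpos hz (by omega)
  have hz0 : 0 < aDegree a z := by
    refine Nat.pos_of_ne_zero fun h => hwz ?_
    rw [aDegree_eq_zero hpos h, aDegree_eq_zero hpos (hdwz.trans h)]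
  -- The decomposition is `x^u - x^v = x^(u-w) (x^w - x^z) + x^z (x^(u-w) - x^(v-z))`.
  have h1 := Ideal.mul_mem_left _ (monomial (u - w) (1 : K)) (hlow w z hdwz hlt)
  have h2 := Ideal.mul_mem_left _ (monomial z (1 : K)) (hlow (u - w) (v - z) (by omega) (by omega))
  rw [monomial_mul_binom, tsub_add_cancel_of_le hw] at h1
  rw [monomial_mul_binom, add_comm z (u - w), add_comm z (v - z), tsub_add_cancel_of_le hz] at h2
  have h3 := add_mem h1 h2
  rw [binom_add_binom] at h3
  exact hnot h3

theorem universalMarkovBasis_subset_graverBasis (hpos : ∀ i, 0 < a i) :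
    universalMarkovBasis K a ⊆ graverBasis K a := by
  rintro f ⟨B, hB, hf⟩
  obtain ⟨u, v, rfl⟩ := hB.1 f hf
  exact mem_graverBasis_iff.mpr ⟨u, v, rfl, hB.isPrimitivePair hpos hf⟩

theorem IsPrimitivePair.isCriticalBinomial {c : Fin n → ℕ}
    (hc : ∀ i, IsCriticalExponent a i (c i)) {r : Fin n →₀ ℕ} {j : Fin n}
    (h : IsPrimitivePair a (Finsupp.single j (c j)) r) :
    IsCriticalBinomial K a j (binom K (Finsupp.single j (c j)) r) := by
  refine ⟨c j, r, hc j, ?_, by rw [← aDegree_single, h.aDegree_eq], rfl⟩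
  exact (h.eq_zero_or j).resolve_left (by simpa using (hc j).pos.ne')

theorem graverBasis_subset_criticalBinomials (hpos : ∀ i, 0 < a i) (hdiv : IsIsolatedDivisible a) :
    graverBasis K a ⊆ criticalBinomials K a := by
  intro f hf
  obtain ⟨u, v, rfl, h⟩ := mem_graverBasis_iff.mp hf
  -- Critical exponents exist only when there is a second variable; the primitive pair supplies one.
  have := h.nontrivial hpos
  choose c hc using exists_isCriticalExponent hpos
  obtain ⟨j, rfl | rfl⟩ := h.exists_eq_single hpos hdiv hc
  · exact ⟨j, .inl (h.isCriticalBinomial hc)⟩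
  · exact ⟨j, .inr (by rw [neg_binom]; exact h.symm.isCriticalBinomial hc)⟩

end MarkovBases

/-! ### Reduced Gröbner bases and standard monomials -/

section GroebnerBases

open MvPolynomial MonomialOrder

variable {n : ℕ} {a : Fin n → ℕ} {K : Type*} [Field K]

/-- `x^v` is the smallest monomial of its `A`-degree, i.e. a standard monomial of the toric
ideal. -/
def IsStandard (m : MonomialOrder (Fin n)) (a : Fin n → ℕ) (v : Fin n →₀ ℕ) : Prop :=
  ∀ t, aDegree a t = aDegree a v → v ≼[m] t

variable {m : MonomialOrder (Fin n)}

theorem exists_isStandard (m : MonomialOrder (Fin n)) (a : Fin n → ℕ) (u : Fin n →₀ ℕ) :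
    ∃ v, aDegree a v = aDegree a u ∧ IsStandard m a v := by
  have hne : (m.toSyn '' {v | aDegree a v = aDegree a u}).Nonempty := ⟨_, u, rfl, rfl⟩
  obtain ⟨_, ⟨v, hv, rfl⟩, hmin⟩ := WellFounded.has_min (wellFounded_lt (α := m.syn)) _ hne
  exact ⟨v, hv, fun t ht => not_lt.mp (hmin _ ⟨t, ht.trans hv, rfl⟩)⟩

theorem IsStandard.eq {v w : Fin n →₀ ℕ} (hv : IsStandard m a v) (hw : IsStandard m a w)
    (h : aDegree a v = aDegree a w) : v = w :=
  m.toSyn.injective (le_antisymm (hv w h.symm) (hw v h))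

theorem IsStandard.of_le {v w : Fin n →₀ ℕ} (hv : IsStandard m a v) (hle : w ≤ v) :
    IsStandard m a w := by
  intro t ht
  have h1 := hv (v - w + t) (by rw [aDegree_add, ht, aDegree_sub_add a hle])
  nth_rewrite 1 [← tsub_add_cancel_of_le hle] at h1
  rw [map_add, map_add] at h1
  exact le_of_add_le_add_left h1

theorem not_isStandard_degree {g : MvPolynomial (Fin n) K} (hg : g ∈ toricIdeal K a)
    (h0 : g ≠ 0) : ¬ IsStandard m a (m.degree g) := by
  intro h
  obtain ⟨t, ht, hne, hd⟩ := exists_mem_support_ne hg (m.degree_mem_support h0)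
  exact hne (m.toSyn.injective (le_antisymm (m.le_degree ht) (h t hd)))

theorem degree_binom {u v : Fin n →₀ ℕ} (h : v ≺[m] u) : m.degree (binom K u v) = u := by
  classical
  have hu : m.degree (monomial u (1 : K)) = u := by simp [degree_monomial]
  have hv : m.degree (monomial v (1 : K)) = v := by simp [degree_monomial]
  rw [binom, degree_sub_of_lt (by rwa [hu, hv]), hu]

theorem monic_binom {u v : Fin n →₀ ℕ} (h : v ≺[m] u) : m.Monic (binom K u v) := by
  rw [MonomialOrder.Monic, leadingCoeff, degree_binom h,
    coeff_binom_left (fun huv => h.ne (congrArg _ huv.symm))]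

theorem binom_ne_zero {u v : Fin n →₀ ℕ} (h : u ≠ v) : binom K u v ≠ 0 := by
  intro h0
  have := coeff_binom_left (K := K) h
  rw [h0, coeff_zero] at this
  exact zero_ne_one this

theorem exists_lt_of_not_isStandard {u : Fin n →₀ ℕ} (hu : ¬ IsStandard m a u) :
    ∃ v, v ≺[m] u ∧ aDegree a v = aDegree a u ∧ IsStandard m a v := by
  obtain ⟨v, hd, hv⟩ := exists_isStandard m a u
  refine ⟨v, lt_of_le_of_ne (hv u hd.symm) fun h => hu ?_, hd, hv⟩
  rwa [← m.toSyn.injective h]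

theorem leadingTerm_image_of_monic {G : Set (MvPolynomial (Fin n) K)}
    (hG : ∀ g ∈ G, m.Monic g) :
    m.leadingTerm '' G = (fun s => monomial s (1 : K)) '' (m.degree '' G) := by
  rw [Set.image_image]
  refine Set.image_congr fun g hg => ?_
  rw [leadingTerm, (hG g hg).leadingCoeff_eq_one]

theorem exists_degree_le {I : Ideal (MvPolynomial (Fin n) K)} {G : Set (MvPolynomial (Fin n) K)}
    (hG : IsReducedGroebnerBasis m I G) {g : MvPolynomial (Fin n) K} (hg : g ∈ I) (h0 : g ≠ 0) :
    ∃ h ∈ G, m.degree h ≤ m.degree g := by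
  have h1 : m.leadingTerm g ∈ Ideal.span (m.leadingTerm '' G) := by
    rw [hG.1.2.2]
    exact Ideal.subset_span ⟨g, hg, rfl⟩
  rw [leadingTerm_image_of_monic hG.2.1, mem_ideal_span_monomial_image] at h1
  obtain ⟨_, ⟨h, hh, rfl⟩, hle⟩ := h1 (m.degree g) (by
    rw [m.support_leadingTerm' h0, Finset.mem_singleton])
  exact ⟨h, hh, hle⟩

theorem exists_degree_le_of_not_isStandard {G : Set (MvPolynomial (Fin n) K)}
    (hG : IsReducedGroebnerBasis m (toricIdeal K a) G) {u : Fin n →₀ ℕ}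
    (hu : ¬ IsStandard m a u) : ∃ h ∈ G, m.degree h ≤ u := by
  obtain ⟨v, hlt, hd, -⟩ := exists_lt_of_not_isStandard hu
  obtain ⟨h, hh, hle⟩ := exists_degree_le hG (binom_mem_toricIdeal hd.symm)
    (binom_ne_zero (fun huv => hlt.ne (congrArg _ huv.symm)))
  rw [degree_binom hlt] at hle
  exact ⟨h, hh, hle⟩

/-- The elements of the reduced Gröbner bases of a toric ideal. -/
structure IsReducedPair (m : MonomialOrder (Fin n)) (a : Fin n → ℕ) (u v : Fin n →₀ ℕ) :
    Prop where
  not_isStandard : ¬ IsStandard m a u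
  isStandard_of_le : ∀ w ≤ u, w ≠ u → IsStandard m a w
  isStandard : IsStandard m a v
  aDegree_eq : aDegree a u = aDegree a v

namespace IsReducedPair

variable {u v : Fin n →₀ ℕ}

theorem lt (h : IsReducedPair m a u v) : v ≺[m] u := by
  refine lt_of_le_of_ne (h.isStandard u h.aDegree_eq) fun he => h.not_isStandard ?_
  rw [← m.toSyn.injective he]
  exact h.isStandard

theorem ne (h : IsReducedPair m a u v) : u ≠ v := fun he => h.lt.ne (congrArg _ he.symm)

/-- A proper divisor of `x^u` and any divisor of `x^v` are standard, so they coincide once their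
degrees agree. -/
theorem isPrimitivePair (hpos : ∀ i, 0 < a i) (h : IsReducedPair m a u v) :
    IsPrimitivePair a u v := by
  refine ⟨h.ne, h.aDegree_eq, fun w z hne hd hw hz => ?_⟩
  have hwu : w = u := by
    by_contra hwu
    exact hne ((h.isStandard_of_le w hw hwu).eq (h.isStandard.of_le hz) hd)
  refine ⟨hwu, eq_of_le_of_aDegree_eq hpos hz ?_⟩
  rw [← hd, hwu, h.aDegree_eq]

end IsReducedPair

theorem IsReducedGroebnerBasis.exists_isReducedPair {G : Set (MvPolynomial (Fin n) K)}
    (hG : IsReducedGroebnerBasis m (toricIdeal K a) G) {g : MvPolynomial (Fin n) K} (hg : g ∈ G) :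
    ∃ u v, g = binom K u v ∧ IsReducedPair m a u v := by
  have hgI := hG.1.2.1 hg
  have hg0 : g ≠ 0 := (hG.2.1 g hg).ne_zero
  -- By reducedness, the only leading exponent dividing a monomial of `g` is its own, and only at
  -- its leading monomial.
  have hstd : ∀ t ∈ g.support, ∀ w ≤ t, w ≠ m.degree g → IsStandard m a w := by
    intro t ht w hw hne
    by_contra hcon
    obtain ⟨h, hh, hle⟩ := exists_degree_le_of_not_isStandard hG hcon
    by_cases hhg : h = g
    · rw [hhg] at hle
      have h1 := m.toSyn_monotone (hle.trans hw)
      have h2 : m.degree g = t := m.toSyn.injective (le_antisymm h1 (m.le_degree ht))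
      exact hne (le_antisymm (by rwa [h2]) hle)
    · exact hG.2.2 g hg h hh hhg t ht (hle.trans hw)
  have hns := not_isStandard_degree (m := m) hgI hg0
  obtain ⟨v, hlt, hd, hv⟩ := exists_lt_of_not_isStandard hns
  have hne : m.degree g ≠ v := fun h => hlt.ne (congrArg _ h.symm)
  refine ⟨m.degree g, v, ?_, hns, fun w hw hne => hstd _ (m.degree_mem_support hg0) w hw hne,
    hv, hd.symm⟩
  by_contra hgb
  have h0 : g - binom K (m.degree g) v ≠ 0 := sub_ne_zero.mpr hgb
  have hI : g - binom K (m.degree g) v ∈ toricIdeal K a :=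
    sub_mem hgI (binom_mem_toricIdeal hd.symm)
  refine not_isStandard_degree (m := m) hI h0 ?_
  have hmem := m.degree_mem_support h0
  -- The leading terms cancel, so `t` is either `v` or a non-leading exponent of `g`. Both are
  -- standard, which a leading exponent of the ideal cannot be.
  set t := m.degree (g - binom K (m.degree g) v)
  have ht : t ≠ m.degree g := by
    intro ht
    rw [ht, mem_support_iff, coeff_sub, coeff_binom_left hne, (hG.2.1 g hg).coeff_degree,
      sub_self] at hmem
    exact hmem rfl
  by_cases htv : t = v
  · rwa [htv]
  · refine hstd t ?_ t le_rfl ht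
    rw [mem_support_iff] at hmem ⊢
    simpa [coeff_binom, ht.symm, Ne.symm htv] using hmem

theorem IsReducedPair.exists_isReducedGroebnerBasis {u v : Fin n →₀ ℕ}
    (h : IsReducedPair m a u v) :
    ∃ G, IsReducedGroebnerBasis m (toricIdeal K a) G ∧ binom K u v ∈ G := by
  set G : Set (MvPolynomial (Fin n) K) :=
    {f | ∃ u v, f = binom K u v ∧ IsReducedPair m a u v} with hGdef
  have hmonic : ∀ g ∈ G, m.Monic g := by
    rintro g ⟨u, v, rfl, h⟩
    exact monic_binom h.lt
  have hexists : ∀ w, ¬ IsStandard m a w → ∃ u v, IsReducedPair m a u v ∧ u ≤ w := by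
    intro w hw
    obtain ⟨u, ⟨huw, hu⟩, hmin⟩ := WellFounded.has_min (wellFounded_lt (α := Fin n →₀ ℕ))
      {u | u ≤ w ∧ ¬ IsStandard m a u} ⟨w, le_rfl, hw⟩
    obtain ⟨v, -, hd, hv⟩ := exists_lt_of_not_isStandard hu
    refine ⟨u, v, ⟨hu, fun t ht hne => ?_, hv, hd.symm⟩, huw⟩
    by_contra hcon
    exact hmin t ⟨ht.trans huw, hcon⟩ (lt_of_le_of_ne ht hne)
  refine ⟨G, ⟨⟨?_, ?_, ?_⟩, hmonic, ?_⟩, u, v, rfl, h⟩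
  · refine Set.Finite.of_finite_image (f := m.degree) ?_ ?_
    -- Dickson's lemma: the leading exponents are minimal non-standard, hence pairwise incomparable.
    · refine IsAntichain.finite_of_wellQuasiOrdered (r := (· ≤ ·)) ?_ wellQuasiOrdered_le
      rintro _ ⟨_, ⟨u, v, rfl, h⟩, rfl⟩ _ ⟨_, ⟨u', v', rfl, h'⟩, rfl⟩ hne hle
      rw [degree_binom h.lt, degree_binom h'.lt] at hle hne
      exact h.not_isStandard (h'.isStandard_of_le u hle hne)
    · rintro _ ⟨u, v, rfl, h⟩ _ ⟨u', v', rfl, h'⟩ he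
      rw [degree_binom h.lt, degree_binom h'.lt] at he
      subst he
      rw [h.isStandard.eq h'.isStandard (h.aDegree_eq.symm.trans h'.aDegree_eq)]
  · rintro _ ⟨u, v, rfl, h⟩
    exact binom_mem_toricIdeal h.aDegree_eq
  · apply le_antisymm
    · refine Ideal.span_mono (Set.image_mono ?_)
      rintro _ ⟨u, v, rfl, h⟩
      exact binom_mem_toricIdeal h.aDegree_eq
    · rw [leadingTerm_image_of_monic hmonic, Ideal.span_le]
      rintro _ ⟨f, hf, rfl⟩
      rw [SetLike.mem_coe, mem_ideal_span_monomial_image]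
      intro t ht
      by_cases hf0 : f = 0
      · simp [hf0] at ht
      rw [m.support_leadingTerm' hf0, Finset.mem_singleton] at ht
      obtain ⟨u, v, huv, hle⟩ := hexists _ (not_isStandard_degree (m := m) hf hf0)
      exact ⟨u, ⟨_, ⟨u, v, rfl, huv⟩, degree_binom huv.lt⟩, ht ▸ hle⟩
  · rintro _ ⟨u, v, rfl, h⟩ _ ⟨u', v', rfl, h'⟩ hne t ht hle
    rw [degree_binom h'.lt] at hle
    rcases eq_or_eq_of_mem_support_binom ht with rfl | rfl
    · by_cases he : u' = t
      · subst he
        exact hne (by rw [h.isStandard.eq h'.isStandard (h.aDegree_eq.symm.trans h'.aDegree_eq)])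
      · exact h'.not_isStandard (h.isStandard_of_le u' hle he)
    · exact h'.not_isStandard (h.isStandard.of_le hle)

theorem mem_universalGroebnerBasis_iff {f : MvPolynomial (Fin n) K} :
    f ∈ universalGroebnerBasis K a ↔
      ∃ (m : MonomialOrder.{0, 0} (Fin n)) (u v : Fin n →₀ ℕ),
        f = binom K u v ∧ IsReducedPair m a u v := by
  constructor
  · rintro ⟨m, G, hG, hf⟩
    obtain ⟨u, v, h⟩ := hG.exists_isReducedPair hf
    exact ⟨m, u, v, h⟩
  · rintro ⟨m, u, v, rfl, h⟩
    obtain ⟨G, hG, hf⟩ := h.exists_isReducedGroebnerBasis (K := K)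
    exact ⟨m, G, hG, hf⟩

theorem universalGroebnerBasis_subset_graverBasis (hpos : ∀ i, 0 < a i) :
    universalGroebnerBasis K a ⊆ graverBasis K a := by
  intro f hf
  obtain ⟨m, u, v, hf, h⟩ := mem_universalGroebnerBasis_iff.mp hf
  exact mem_graverBasis_iff.mpr ⟨u, v, hf, h.isPrimitivePair hpos⟩

end GroebnerBases

/-! ### Circuits and the universal Gröbner basis -/

section Circuits

open MvPolynomial MonomialOrder

variable {n : ℕ} {a : Fin n → ℕ} {K : Type*} [Field K]

theorem lt_of_lex_lt_single {σ : Type*} [LinearOrder σ] [WellFoundedGT σ] {t : σ →₀ ℕ} {i : σ}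
    {α : ℕ} (h : t ≺[MonomialOrder.lex] Finsupp.single i α) :
    t i < α ∧ ∀ k < i, t k = 0 := by
  classical
  rw [MonomialOrder.lex_lt_iff] at h
  obtain ⟨j, hj, hlt⟩ := h
  simp only [ofLex_toLex] at hj hlt
  obtain rfl : j = i := by
    by_contra hne
    rw [Finsupp.single_eq_of_ne hne] at hlt
    omega
  refine ⟨by simpa using hlt, fun k hk => ?_⟩
  rw [hj k hk, Finsupp.single_eq_of_ne hk.ne]

/-- A lexicographic order whose two smallest variables are `x_i > x_j`. -/
theorem exists_lex_order {i j : Fin n} (hij : i ≠ j) :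
    ∃ m : MonomialOrder.{0, 0} (Fin n), ∀ (t : Fin n →₀ ℕ) (α : ℕ),
      (t ≺[m] Finsupp.single i α → t i < α ∧ ∀ k, k ≠ i → k ≠ j → t k = 0) ∧
      (t ≺[m] Finsupp.single j α → ∀ k, k ≠ j → t k = 0) := by
  -- Variables with a larger index are smaller in the lexicographic order, so `i` and `j` are moved
  -- behind all others.
  let f : Fin n → ℕ := fun k => if k = j then n + 1 else if k = i then n else k
  have hf : Function.Injective f := by
    intro k l h
    have := k.2
    have := l.2
    simp only [f] at h
    split_ifs at h with h1 h2 h3 h4 h5 h6 <;> omega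
  let o : LinearOrder (Fin n) := LinearOrder.lift' f hf
  have hwf : @WellFoundedGT (Fin n) o.toLT := @Finite.to_wellFoundedGT (Fin n) _ o.toPreorder
  refine ⟨@MonomialOrder.lex (Fin n) o hwf, fun t α => ⟨fun h => ?_, fun h => ?_⟩⟩
  · obtain ⟨h1, h2⟩ := @lt_of_lex_lt_single (Fin n) o hwf t i α h
    refine ⟨h1, fun k hki hkj => h2 k ?_⟩
    change f k < f i
    simp [f, hki, hkj, hij]
  · obtain ⟨-, h2⟩ := @lt_of_lex_lt_single (Fin n) o hwf t j α h
    refine fun k hkj => h2 k ?_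
    change f k < f j
    have := k.2
    simp only [f, hkj, if_false, if_true]
    split_ifs <;> omega

theorem support_pair_gcd {i j : Fin n} (hij : i ≠ j) {α β : ℕ} (hα : 0 < α) (hβ : 0 < β) :
    (Finsupp.single i α + Finsupp.single j β).support.gcd
      (Finsupp.single i α + Finsupp.single j β) = Nat.gcd α β := by
  classical
  have hs : (Finsupp.single i α + Finsupp.single j β).support = {i, j} := by
    ext k
    simp only [Finsupp.mem_support_iff, Finsupp.add_apply, Finset.mem_insert,
      Finset.mem_singleton, Finsupp.single_apply]
    split_ifs <;> grind
  rw [hs, Finset.gcd_insert, Finset.gcd_singleton]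
  simp [hij, hij.symm]
  rfl

/-- With `x_i > x_j` the smallest variables, only monomials in these two can lie below a power of
`x_i`, and coprimality makes `α` the least exponent for which such a monomial has the same degree.
-/
theorem isReducedPair_of_coprime (hpos : ∀ i, 0 < a i) {i j : Fin n} (hij : i ≠ j) {α β : ℕ}
    (hα : 0 < α) (hd : α * a i = β * a j) (hcop : Nat.Coprime α β) :
    ∃ m : MonomialOrder.{0, 0} (Fin n),
      IsReducedPair m a (Finsupp.single i α) (Finsupp.single j β) := by
  obtain ⟨m, hm⟩ := exists_lex_order hij
  have hstdj : ∀ β, IsStandard m a (Finsupp.single j β) := by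
    intro β t ht
    by_contra! hlt
    have h1 := (hm t β).2 hlt
    have h2 : t = Finsupp.single j (t j) := by
      ext k
      by_cases hk : k = j
      · simp [hk]
      · rw [h1 k hk, Finsupp.single_eq_of_ne hk]
    rw [h2, aDegree_single, aDegree_single] at ht
    rw [h2, Nat.eq_of_mul_eq_mul_right (hpos j) ht] at hlt
    exact hlt.false
  have hstdi : ∀ s < α, IsStandard m a (Finsupp.single i s) := by
    intro s hs t ht
    by_contra! hlt
    obtain ⟨h1, h2⟩ := (hm t s).1 hlt
    have h3 : t = Finsupp.single i (t i) + Finsupp.single j (t j) := by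
      ext k
      by_cases hk : k = i
      · subst hk
        simp [hij]
      · by_cases hkj : k = j
        · subst hkj
          simp [hk]
        · simp [h2 k hk hkj, Finsupp.single_eq_of_ne hk, Finsupp.single_eq_of_ne hkj]
    rw [h3, aDegree_add, aDegree_single, aDegree_single, aDegree_single] at ht
    obtain ⟨q, rfl⟩ := Nat.exists_eq_add_of_lt h1
    have h4 : t j * a j = (q + 1) * a i := by linarith
    have h5 : α * (t j) = (q + 1) * β := by
      apply Nat.eq_of_mul_eq_mul_right (Nat.mul_pos (hpos i) (hpos j))
      calc α * t j * (a i * a j) = (α * a i) * (t j * a j) := by ring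
        _ = (q + 1) * β * (a i * a j) := by rw [h4, hd]; ring
    have h6 : α ∣ q + 1 := hcop.dvd_of_dvd_mul_right (h5 ▸ dvd_mul_right α (t j))
    have := Nat.le_of_dvd (by omega) h6
    omega
  refine ⟨m, fun h => ?_, fun w hw hne => ?_, hstdj β, by rw [aDegree_single, aDegree_single, hd]⟩
  · have h1 := h.eq (hstdj β) (by rw [aDegree_single, aDegree_single, hd])
    have h2 := DFunLike.congr_fun h1 i
    rw [Finsupp.single_eq_same, Finsupp.single_eq_of_ne hij] at h2
    omega
  · have h1 : w = Finsupp.single i (w i) := by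
      ext k
      by_cases hk : k = i
      · simp [hk]
      · have := hw k
        rw [Finsupp.single_eq_of_ne hk] at this ⊢
        omega
    have h2 := hw i
    rw [Finsupp.single_eq_same] at h2
    rw [h1]
    refine hstdi _ (lt_of_le_of_ne h2 fun h => hne ?_)
    rw [h1, h]

theorem eq_single_of_support_subset {u : Fin n →₀ ℕ} {i : Fin n} (h : u.support ⊆ {i}) :
    u = Finsupp.single i (u i) := by
  ext k
  by_cases hk : k = i
  · simp [hk]
  · rw [Finsupp.single_eq_of_ne hk]
    by_contra hne
    exact hk (by simpa using h (Finsupp.mem_support_iff.mpr hne))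

/-- The circuits are the binomials `x_i ^ α - x_j ^ β` with coprime exponents. -/
theorem mem_circuits_iff (hpos : ∀ i, 0 < a i) {f : MvPolynomial (Fin n) K} :
    f ∈ circuits K a ↔ ∃ i j α β, i ≠ j ∧ 0 < α ∧ 0 < β ∧ α * a i = β * a j ∧ Nat.Coprime α β ∧
      f = binom K (Finsupp.single i α) (Finsupp.single j β) := by
  classical
  simp only [circuits, Set.mem_ofPred_eq, binom_mem_toricIdeal_iff]
  constructor
  · rintro ⟨u, v, rfl, huv, hd, hdisj, hgcd, hmin⟩
    have hne : u ≠ 0 ∧ v ≠ 0 := by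
      constructor
      · rintro rfl
        exact huv (aDegree_eq_zero hpos (by simpa using hd.symm)).symm
      · rintro rfl
        exact huv (aDegree_eq_zero hpos (by simpa using hd))
    obtain ⟨i, hi⟩ := Finsupp.support_nonempty_iff.mpr hne.1
    obtain ⟨j, hj⟩ := Finsupp.support_nonempty_iff.mpr hne.2
    have hij : i ≠ j := fun h => Finset.disjoint_left.mp hdisj hi (h ▸ hj)
    have hsi : (Finsupp.single i (a j)).support = {i} :=
      Finsupp.support_single _ (hpos j).ne'
    have hsj : (Finsupp.single j (a i)).support = {j} :=
      Finsupp.support_single _ (hpos i).ne'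
    -- The binomial `x_i ^ (a j) - x_j ^ (a i)` bounds a minimal support by two variables.
    have h1 := hmin (Finsupp.single i (a j)) (Finsupp.single j (a i))
      (fun h => hij (by simpa [hsi, hsj] using congrArg Finsupp.support h))
      (by rw [aDegree_single, aDegree_single, mul_comm])
    rw [hsi, hsj] at h1
    have hsub : ({i} ∪ {j} : Finset (Fin n)) ⊆ u.support ∪ v.support :=
      Finset.union_subset_union (by simpa using hi) (by simpa using hj)
    have hsup : u.support ∪ v.support ⊆ {i} ∪ {j} := by
      by_contra hcon
      exact h1 ⟨hsub, hcon⟩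
    have hu : u = Finsupp.single i (u i) := by
      refine eq_single_of_support_subset fun k hk => ?_
      rcases Finset.mem_union.mp (hsup (Finset.mem_union_left _ hk)) with h | h
      · exact h
      · rw [Finset.mem_singleton.mp h] at hk
        exact absurd hj (Finset.disjoint_left.mp hdisj hk)
    have hv : v = Finsupp.single j (v j) := by
      refine eq_single_of_support_subset fun k hk => ?_
      rcases Finset.mem_union.mp (hsup (Finset.mem_union_right _ hk)) with h | h
      · rw [Finset.mem_singleton.mp h] at hk
        exact absurd hk (Finset.disjoint_left.mp hdisj hi)
      · exact h
    have hi0 : 0 < u i := Nat.pos_of_ne_zero (by simpa using hi)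
    have hj0 : 0 < v j := Nat.pos_of_ne_zero (by simpa using hj)
    refine ⟨i, j, u i, v j, hij, hi0, hj0, ?_, ?_, by rw [← hu, ← hv]⟩
    · rwa [hu, hv, aDegree_single, aDegree_single] at hd
    · rwa [hu, hv, support_pair_gcd hij hi0 hj0] at hgcd
  · rintro ⟨i, j, α, β, hij, hα, hβ, hd, hcop, rfl⟩
    have hsi : (Finsupp.single i α).support = {i} := Finsupp.support_single _ hα.ne'
    have hsj : (Finsupp.single j β).support = {j} := Finsupp.support_single _ hβ.ne'
    refine ⟨_, _, rfl, fun h => hij (by simpa [hsi, hsj] using congrArg Finsupp.support h),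
      by rw [aDegree_single, aDegree_single, hd], by simpa [hsi, hsj] using hij, ?_, ?_⟩
    · rw [support_pair_gcd hij hα hβ]
      exact hcop
    · intro u v huv hduv hlt
      rw [hsi, hsj] at hlt
      obtain ⟨k, hk, hknot⟩ := Finset.exists_of_ssubset hlt
      obtain ⟨l, hl⟩ : ∃ l, u.support ∪ v.support ⊆ {l} := by
        have hsub : ∀ x ∈ u.support ∪ v.support, (x = i ∨ x = j) ∧ x ≠ k := fun x hx =>
          ⟨by simpa using hlt.subset hx, fun h => hknot (h ▸ hx)⟩
        rcases (by simpa using hk : k = i ∨ k = j) with rfl | rfl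
        · exact ⟨j, fun x hx => by simpa using (hsub x hx).1.resolve_left (hsub x hx).2⟩
        · exact ⟨i, fun x hx => by simpa using (hsub x hx).1.resolve_right (hsub x hx).2⟩
      have hu := eq_single_of_support_subset (Finset.subset_union_left.trans hl)
      have hv := eq_single_of_support_subset (Finset.subset_union_right.trans hl)
      rw [hu, hv, aDegree_single, aDegree_single] at hduv
      exact huv (by rw [hu, hv, Nat.eq_of_mul_eq_mul_right (hpos l) hduv])

theorem circuits_subset_universalGroebnerBasis (hpos : ∀ i, 0 < a i) :
    circuits K a ⊆ universalGroebnerBasis K a := by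
  intro f hf
  obtain ⟨i, j, α, β, hij, hα, -, hd, hcop, rfl⟩ := (mem_circuits_iff hpos).mp hf
  obtain ⟨m, hm⟩ := isReducedPair_of_coprime hpos hij hα hd hcop
  exact mem_universalGroebnerBasis_iff.mpr ⟨m, _, _, rfl, hm⟩

/-- Dividing both exponents by their gcd stays in the ideal, so primitivity makes the gcd 1. -/
theorem IsPrimitivePair.binom_mem_circuits (hpos : ∀ i, 0 < a i) {i j : Fin n} {α β : ℕ}
    (h : IsPrimitivePair a (Finsupp.single i α) (Finsupp.single j β)) :
    binom K (Finsupp.single i α) (Finsupp.single j β) ∈ circuits K a := by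
  have hα : α ≠ 0 := by simpa using h.left_ne_zero hpos
  have hβ : β ≠ 0 := by simpa using h.symm.left_ne_zero hpos
  have hij : i ≠ j := by
    rintro rfl
    rcases h.eq_zero_or i with h0 | h0
    · exact hα (by simpa using h0)
    · exact hβ (by simpa using h0)
  have hd := h.aDegree_eq
  rw [aDegree_single, aDegree_single] at hd
  refine (mem_circuits_iff hpos).mpr ⟨i, j, α, β, hij, Nat.pos_of_ne_zero hα,
    Nat.pos_of_ne_zero hβ, hd, ?_, rfl⟩
  obtain ⟨p, hp⟩ := Nat.gcd_dvd_left α β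
  obtain ⟨q, hq⟩ := Nat.gcd_dvd_right α β
  have hg : 0 < Nat.gcd α β := Nat.gcd_pos_of_pos_left _ (Nat.pos_of_ne_zero hα)
  have hp0 : p ≠ 0 := by
    rintro rfl
    exact hα hp
  have hle : p ≤ α := Nat.le_of_dvd (Nat.pos_of_ne_zero hα) ⟨_, hp.trans (mul_comm _ _)⟩
  have hle' : q ≤ β := Nat.le_of_dvd (Nat.pos_of_ne_zero hβ) ⟨_, hq.trans (mul_comm _ _)⟩
  have hpq : p * a i = q * a j := by
    apply Nat.eq_of_mul_eq_mul_left hg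
    rw [← mul_assoc, ← mul_assoc, ← hp, ← hq, hd]
  have h1 := (h.eq_of_le (Finsupp.single i p) (Finsupp.single j q) (fun he => ?_)
    (by rw [aDegree_single, aDegree_single, hpq]) (by simpa using hle) (by simpa using hle')).1
  · have h2 := DFunLike.congr_fun h1 i
    rw [Finsupp.single_eq_same, Finsupp.single_eq_same] at h2
    rw [h2] at hp
    exact Nat.eq_of_mul_eq_mul_right (Nat.pos_of_ne_zero hα) (by rw [one_mul, ← hp])
  · have h2 := DFunLike.congr_fun he i
    rw [Finsupp.single_eq_same, Finsupp.single_eq_of_ne hij] at h2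
    exact hp0 h2

theorem exists_eq_single_of_isStandard (hpos : ∀ i, 0 < a i) (hdiv : IsIsolatedDivisible a)
    {c : Fin n → ℕ} (hc : ∀ i, IsCriticalExponent a i (c i)) {m : MonomialOrder (Fin n)}
    {r : Fin n →₀ ℕ} (hr0 : r ≠ 0) (hr : ∀ i, c i ∣ r i) {j : Fin n}
    (hd : aDegree a r = c j * a j) (hstd : ∀ w ≤ r, w ≠ r → IsStandard m a w) :
    ∃ i, r = Finsupp.single i (r i) := by
  obtain ⟨i, hi⟩ := Finsupp.support_nonempty_iff.mpr hr0
  refine ⟨i, eq_single_of_support_subset fun k hk => ?_⟩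
  by_contra hki
  obtain ⟨w, z, hne, hdeq, hw, hz, hw', hz'⟩ := exists_proper_divisors hpos hdiv hc hr hd
    (Finsupp.mem_support_iff.mp hi) (Finsupp.mem_support_iff.mp hk)
    (fun h => hki (by simp [h]))
  exact hne ((hstd w hw hw').eq (hstd z hz hz') hdeq)

theorem universalGroebnerBasis_subset_circuits (hpos : ∀ i, 0 < a i)
    (hdiv : IsIsolatedDivisible a) : universalGroebnerBasis K a ⊆ circuits K a := by
  intro f hf
  obtain ⟨m, u, v, rfl, hred⟩ := mem_universalGroebnerBasis_iff.mp hf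
  have h := hred.isPrimitivePair hpos
  have := h.nontrivial hpos
  choose c hc using exists_isCriticalExponent hpos
  obtain ⟨j, rfl | rfl⟩ := h.exists_eq_single hpos hdiv hc
  · obtain ⟨i, hi⟩ := exists_eq_single_of_isStandard hpos hdiv hc (h.symm.left_ne_zero hpos)
      (h.symm.dvd_left hpos hdiv hc) (by rw [← h.aDegree_eq, aDegree_single])
      -- Here the remaining side is the standard one; in the other case it is the leading one, whose
      -- proper divisors are still standard.
      (fun w hw _ => hred.isStandard.of_le hw)
    rw [hi] at h ⊢
    exact h.binom_mem_circuits hpos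
  · obtain ⟨i, hi⟩ := exists_eq_single_of_isStandard hpos hdiv hc (h.left_ne_zero hpos)
      (h.dvd_left hpos hdiv hc) (by rw [h.aDegree_eq, aDegree_single]) hred.isStandard_of_le
    rw [hi] at h ⊢
    exact h.binom_mem_circuits hpos

end Circuits

end ToricBases

theorem theorem3p11 {K : Type*} [Field K] {n : ℕ} (S : AddSubmonoid ℕ) (a : Fin n → ℕ)
    (hS : ToricBases.IsNumericalSemigroup S)
    (ha : ToricBases.IsMinimallyGeneratedBy S a)
    (hB : ToricBases.IsBettiDivisible K a) :
    ToricBases.circuits K a = ToricBases.universalGroebnerBasis K a ∧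
    ToricBases.universalGroebnerBasis K a ⊆ ToricBases.criticalBinomials K a ∧
    ToricBases.criticalBinomials K a = ToricBases.universalMarkovBasis K a ∧
    ToricBases.universalMarkovBasis K a = ToricBases.graverBasis K a := by
  have hdiv := ToricBases.isIsolatedDivisible_of_isBettiDivisible hB
  have hGrCr := ToricBases.graverBasis_subset_criticalBinomials (K := K) ha.pos hdiv
  have hCrM := ToricBases.criticalBinomials_subset_universalMarkovBasis (K := K) ha.pos
  have hMGr := ToricBases.universalMarkovBasis_subset_graverBasis (K := K) ha.pos
  exact ⟨(ToricBases.circuits_subset_universalGroebnerBasis ha.pos).antisymm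
      (ToricBases.universalGroebnerBasis_subset_circuits ha.pos hdiv),
    (ToricBases.universalGroebnerBasis_subset_graverBasis ha.pos).trans hGrCr,
    hCrM.antisymm (hMGr.trans hGrCr), hMGr.antisymm (hGrCr.trans hCrM)⟩
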